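/- Let $L>0$ and let $\gamma$ be a real number. Consider the control system $$q'(z)=i\gamma|q(z)|^2q(z)+n(z),\qquad 0\le z\le L,$$ with complex-valued state $q$, where the noise $n$ ranges over the continuous functions $[0,L]\to\mathbb{C}$. For $x,y\in\mathbb{C}$ and a real number $\epsilon$, write $y\in S_\epsilon(x)$ if there are a continuous $n:[0,L]\to\mathbb{C}$ with $\int_0^L|n(z)|^2\,dz=\epsilon$ and a solution $q$ of this equation on $[0,L]$ with $q(0)=x$ and $q(L)=y$. The noise ball of $x$ with effort $E$ is $B_E(x)=\bigcup_{\epsilon\le E}S_\epsilon(x)$. Let $x\in\mathbb{C}$ and $E'>E>0$. Then $B_E(x)$ is a proper subset of $B_{E'}(x)$. Moreover, for every boundary point $y$ of $B_E(x)$ there is a neighborhood of $y$ in $\mathbb{C}$ that is contained in $B_{E'}(x)$. -/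

import Mathlib

noncomputable section

namespace PerSample

/-- The admissible noise (control) signals on a fiber of length `L`: functions that are continuous
on `[0, L]`. Values outside `[0, L]` are never used. -/
def controls (L : ℝ) : Set (ℝ → ℂ) :=
  {n | ContinuousOn n (Set.Icc 0 L)}

/-- `q` is a trajectory from `x` under the noise `n`: `q 0 = x` and
`q' = i γ |q|² q + n` on `[0, L]` (one-sided derivatives at the two endpoints). -/
def IsTrajectory (γ L : ℝ) (x : ℂ) (n q : ℝ → ℂ) : Prop :=
  q 0 = x ∧
    ∀ z ∈ Set.Icc (0 : ℝ) L,
      HasDerivWithinAt q (Complex.I * (γ : ℂ) * ((‖q z‖ ^ 2 : ℝ) : ℂ) * q z + n z)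
        (Set.Icc 0 L) z

/-- `y = N(x, n)`: the channel output for the input `x` and the noise `n` is `y`, i.e. the
trajectory from `x` under `n` ends in `y` at `z = L`. -/
def IsOutput (γ L : ℝ) (x : ℂ) (n : ℝ → ℂ) (y : ℂ) : Prop :=
  ∃ q : ℝ → ℂ, IsTrajectory γ L x n q ∧ q L = y

/-- The energy of the noise, `∫₀ᴸ |n(z)|² dz`. -/
def energy (L : ℝ) (n : ℝ → ℂ) : ℝ :=
  ∫ z in (0 : ℝ)..L, ‖n z‖ ^ 2

/-- `S_E(x)`: the outputs into which `x` can be transformed with energy exactly `E`. -/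
def reachSet (γ L E : ℝ) (x : ℂ) : Set ℂ :=
  {y | ∃ n ∈ controls L, IsOutput γ L x n y ∧ energy L n = E}

/-- The noise ball `B_E(x)`: the union of `S_ε(x)` over all `ε ≤ E`. -/
def noiseBall (γ L E : ℝ) (x : ℂ) : Set ℂ :=
  ⋃ (ε : ℝ) (_ : ε ≤ E), reachSet γ L ε x

end PerSample

end

/-!
The noise balls thicken uniformly: there is a `δ > 0`, depending only on `γ`, `L`, `x`, `E`, `E'`,
such that every disc of radius `δ` about a point of `B_E(x)` lies in `B_{E'}(x)`
(`exists_ball_subset_noiseBall`). Indeed, if the trajectory `q` ends in `y`, then `q + (z / L) v`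
is a trajectory ending in `y + v`, for a noise that differs from the original one by `O(‖v‖)`. The
implied constant is uniform because the Kerr term is Lipschitz on bounded sets
(`norm_kerr_sub_le`) and trajectories of bounded energy are uniformly bounded
(`IsTrajectory.norm_sq_le`): the Kerr term is orthogonal to `q` and so does not change `‖q‖`.

The claim about the boundary follows at once. If the two balls were equal, the nonempty set
`B_E(x)` would contain the `δ`-disc about each of its points, hence be all of `ℂ`, although it is
bounded.
-/

namespace PerSample

open Set

/-! ### Trajectories of bounded energy -/

theorem IsTrajectory.continuousOn {γ L : ℝ} {x : ℂ} {n q : ℝ → ℂ} (h : IsTrajectory γ L x n q) :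
    ContinuousOn q (Icc 0 L) :=
  fun z hz => (h.2 z hz).continuousWithinAt

theorem intervalIntegrable_norm_sq {L : ℝ} {n : ℝ → ℂ} (hn : n ∈ controls L) {z : ℝ}
    (hz : z ∈ Icc 0 L) : IntervalIntegrable (fun s => ‖n s‖ ^ 2) MeasureTheory.volume 0 z := by
  apply ContinuousOn.intervalIntegrable
  rw [uIcc_of_le hz.1]
  exact (ContinuousOn.mono hn (Icc_subset_Icc_right hz.2)).norm.pow 2

/-- Gronwall bound. Since the Kerr term is orthogonal to `q`, the derivative of `‖q‖ ^ 2` is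
`2 ⟪q, n⟫ ≤ ‖q‖ ^ 2 + ‖n‖ ^ 2`. -/
theorem IsTrajectory.norm_sq_le {γ L : ℝ} {x : ℂ} {n q : ℝ → ℂ} (h : IsTrajectory γ L x n q)
    (hL : 0 < L) (hn : n ∈ controls L) {z : ℝ} (hz : z ∈ Icc 0 L) :
    ‖q z‖ ^ 2 ≤ Real.exp L * (‖x‖ ^ 2 + energy L n) := by
  have hsq : ContinuousOn (fun s => ‖n s‖ ^ 2) (Icc 0 L) := ContinuousOn.pow (ContinuousOn.norm hn) 2
  set G : ℝ → ℝ := fun z => Real.exp (-z) * ‖q z‖ ^ 2 - ∫ s in (0 : ℝ)..z, ‖n s‖ ^ 2 with hG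
  have hGd : ∀ t ∈ Ioo (0 : ℝ) L, ∃ d ≤ 0, HasDerivAt G d t := by
    intro t ht
    have htI := Ioo_subset_Icc_self ht
    have hnhds : Icc 0 L ∈ nhds t := Icc_mem_nhds ht.1 ht.2
    have h1 := ((h.2 t htI).hasDerivAt hnhds).norm_sq
    have h2 : HasDerivAt (fun s : ℝ => Real.exp (-s)) (Real.exp (-t) * -1) t :=
      (hasDerivAt_neg t).exp
    have h3 : HasDerivAt (fun z => ∫ s in (0 : ℝ)..z, ‖n s‖ ^ 2) (‖n t‖ ^ 2) t := by
      apply intervalIntegral.integral_hasDerivAt_right (intervalIntegrable_norm_sq hn htI)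
      · exact ContinuousOn.stronglyMeasurableAtFilter_nhdsWithin
          (hsq.mono Ioo_subset_Icc_self) measurableSet_Ioo t |>.filter_mono
          (by rw [isOpen_Ioo.nhdsWithin_eq ht])
      · exact hsq.continuousAt hnhds
    refine ⟨_, ?_, (h2.mul h1).sub h3⟩
    have hk : inner ℝ (q t) (Complex.I * (γ : ℂ) * ((‖q t‖ ^ 2 : ℝ) : ℂ) * q t + n t)
        = inner ℝ (q t) (n t) := by
      rw [inner_add_right, add_eq_right]
      simp only [Complex.inner, Complex.mul_re, Complex.mul_im, Complex.conj_re, Complex.conj_im,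
        Complex.I_re, Complex.I_im, Complex.ofReal_re, Complex.ofReal_im]
      ring
    rw [hk]
    have hin := real_inner_le_norm (q t) (n t)
    have he0 := Real.exp_pos (-t)
    have he1 : Real.exp (-t) ≤ 1 := Real.exp_le_one_iff.2 (by linarith [ht.1])
    have hdiff : 2 * inner ℝ (q t) (n t) - ‖q t‖ ^ 2 ≤ ‖n t‖ ^ 2 := by
      nlinarith [sq_nonneg (‖q t‖ - ‖n t‖)]
    have := mul_le_mul_of_nonneg_left hdiff he0.le
    have := mul_le_mul_of_nonneg_right he1 (sq_nonneg ‖n t‖)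
    linarith
  have hGc : ContinuousOn G (Icc 0 L) := by
    refine ContinuousOn.sub ((by fun_prop : Continuous fun s : ℝ => Real.exp (-s)).continuousOn.mul
      (h.continuousOn.norm.pow 2)) ?_
    have := intervalIntegral.continuousOn_primitive_interval (μ := MeasureTheory.volume)
      (f := fun s => ‖n s‖ ^ 2) (a := 0) (b := L)
      (by rw [uIcc_of_le hL.le]; exact hsq.integrableOn_Icc)
    rwa [uIcc_of_le hL.le] at this
  have hanti : AntitoneOn G (Icc 0 L) := by
    apply antitoneOn_of_deriv_nonpos (convex_Icc 0 L) hGc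
    · rw [interior_Icc]
      intro t ht
      obtain ⟨d, _, hd⟩ := hGd t ht
      exact hd.differentiableAt.differentiableWithinAt
    · rw [interior_Icc]
      intro t ht
      obtain ⟨d, hd0, hd⟩ := hGd t ht
      rwa [hd.deriv]
  have hle : G z ≤ G 0 := hanti ⟨le_rfl, hL.le⟩ hz hz.1
  have hint : ∫ s in (0 : ℝ)..z, ‖n s‖ ^ 2 ≤ energy L n :=
    intervalIntegral.integral_mono_interval le_rfl hz.1 hz.2
      (Filter.Eventually.of_forall fun s => sq_nonneg _)
      (intervalIntegrable_norm_sq hn ⟨hL.le, le_rfl⟩)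
  simp only [hG, neg_zero, Real.exp_zero, one_mul, intervalIntegral.integral_same, sub_zero,
    h.1] at hle
  have hfin : Real.exp (-z) * ‖q z‖ ^ 2 ≤ ‖x‖ ^ 2 + energy L n := by linarith
  calc ‖q z‖ ^ 2 = Real.exp z * (Real.exp (-z) * ‖q z‖ ^ 2) := by
        rw [← mul_assoc, ← Real.exp_add, add_neg_cancel, Real.exp_zero, one_mul]
    _ ≤ Real.exp L * (‖x‖ ^ 2 + energy L n) := by
        have : 0 ≤ Real.exp (-z) * ‖q z‖ ^ 2 := by positivity
        gcongr
        exact hz.2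

/-! ### Perturbing the endpoint -/

/-- The Kerr term `|a|² a` is Lipschitz on every disc. -/
theorem norm_kerr_sub_le {M : ℝ} {a b : ℂ} (ha : ‖a‖ ≤ M) (hb : ‖b‖ ≤ M) :
    ‖((‖a‖ ^ 2 : ℝ) : ℂ) * a - ((‖b‖ ^ 2 : ℝ) : ℂ) * b‖ ≤ 3 * M ^ 2 * ‖a - b‖ := by
  have hM : 0 ≤ M := (norm_nonneg a).trans ha
  have key : ((‖a‖ ^ 2 : ℝ) : ℂ) * a - ((‖b‖ ^ 2 : ℝ) : ℂ) * b
      = ((‖a‖ ^ 2 : ℝ) : ℂ) * (a - b) + (((‖a‖ + ‖b‖) * (‖a‖ - ‖b‖) : ℝ) : ℂ) * b := by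
    push_cast; ring
  rw [key]
  refine (norm_add_le _ _).trans ?_
  rw [norm_mul, norm_mul, Complex.norm_real, Complex.norm_real, norm_mul, norm_pow, norm_norm,
    Real.norm_of_nonneg (by positivity : 0 ≤ ‖a‖ + ‖b‖)]
  have h1 : ‖‖a‖ - ‖b‖‖ ≤ ‖a - b‖ := abs_norm_sub_norm_le a b
  calc ‖a‖ ^ 2 * ‖a - b‖ + (‖a‖ + ‖b‖) * ‖‖a‖ - ‖b‖‖ * ‖b‖
      ≤ M ^ 2 * ‖a - b‖ + (M + M) * ‖a - b‖ * M := by gcongr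
    _ = 3 * M ^ 2 * ‖a - b‖ := by ring

/-- The endpoint of a trajectory can be moved by any small `v`, at a cost in energy that is linear
in `‖v‖` and depends on the trajectory only through a bound `R` on its size. -/
theorem IsTrajectory.exists_isOutput_add {γ L R : ℝ} {x : ℂ} {n q : ℝ → ℂ}
    (h : IsTrajectory γ L x n q) (hL : 0 < L) (hn : n ∈ controls L)
    (hR : ∀ z ∈ Icc 0 L, ‖q z‖ ≤ R) {v : ℂ} (hv : ‖v‖ ≤ 1) :
    ∃ m ∈ controls L, IsOutput γ L x m (q L + v) ∧
      energy L m ≤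
        energy L n + ‖v‖ * (energy L n + 2 * (1 / L + |γ| * (3 * (R + 1) ^ 2)) ^ 2 * L) := by
  set K : ℝ := 1 / L + |γ| * (3 * (R + 1) ^ 2) with hK
  have hK0 : 0 ≤ K := by positivity
  set p : ℝ → ℂ := fun z => q z + ((z / L : ℝ) : ℂ) * v with hp
  set m : ℝ → ℂ := fun z => n z + (((1 / L : ℝ) : ℂ) * v -
    Complex.I * (γ : ℂ) * (((‖p z‖ ^ 2 : ℝ) : ℂ) * p z - ((‖q z‖ ^ 2 : ℝ) : ℂ) * q z)) with hm
  have hqc := h.continuousOn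
  have hpc : ContinuousOn p (Icc 0 L) := hqc.add (by fun_prop)
  have hkc : ∀ {f : ℝ → ℂ}, ContinuousOn f (Icc 0 L) →
      ContinuousOn (fun z => ((‖f z‖ ^ 2 : ℝ) : ℂ) * f z) (Icc 0 L) := fun hf =>
    (Complex.continuous_ofReal.comp_continuousOn (hf.norm.pow 2)).mul hf
  have hmc : m ∈ controls L :=
    ContinuousOn.add hn (continuousOn_const.sub (continuousOn_const.mul ((hkc hpc).sub (hkc hqc))))
  refine ⟨m, hmc, ⟨p, ⟨by simp [hp, h.1], fun z hz => ?_⟩, by simp [hp, hL.ne']⟩, ?_⟩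
  · have h1 : HasDerivAt (fun z : ℝ => ((z / L : ℝ) : ℂ) * v) (((1 / L : ℝ) : ℂ) * v) z :=
      (((hasDerivAt_id z).div_const L).ofReal_comp).mul_const v
    refine ((h.2 z hz).add h1.hasDerivWithinAt).congr_deriv ?_
    simp only [hm]
    ring
  have hmn : ∀ z ∈ Icc 0 L, ‖m z‖ ≤ ‖n z‖ + K * ‖v‖ := by
    intro z hz
    have hzv : ‖((z / L : ℝ) : ℂ) * v‖ ≤ ‖v‖ := by
      rw [norm_mul, Complex.norm_real, Real.norm_of_nonneg (div_nonneg hz.1 hL.le)]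
      exact mul_le_of_le_one_left (norm_nonneg v) ((div_le_one hL).2 hz.2)
    have hpz : ‖p z‖ ≤ R + 1 :=
      (norm_add_le _ _).trans (add_le_add (hR z hz) (hzv.trans hv))
    have hpq : ‖p z - q z‖ ≤ ‖v‖ := by simpa only [hp, add_sub_cancel_left] using hzv
    have hker := norm_kerr_sub_le hpz ((hR z hz).trans (by linarith))
    refine (norm_add_le _ _).trans (add_le_add le_rfl ((norm_sub_le _ _).trans ?_))
    rw [norm_mul, norm_mul, norm_mul, Complex.norm_I, Complex.norm_real, Complex.norm_real,
      Real.norm_of_nonneg (by positivity : 0 ≤ 1 / L), one_mul, Real.norm_eq_abs]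
    calc 1 / L * ‖v‖ + |γ| * ‖((‖p z‖ ^ 2 : ℝ) : ℂ) * p z - ((‖q z‖ ^ 2 : ℝ) : ℂ) * q z‖
        ≤ 1 / L * ‖v‖ + |γ| * (3 * (R + 1) ^ 2 * ‖v‖) := by
          gcongr
          exact hker.trans (by gcongr)
      _ = K * ‖v‖ := by rw [hK]; ring
  -- Young's inequality `2 K ‖n‖ ≤ ‖n‖ ^ 2 + K ^ 2`, together with `‖v‖ ^ 2 ≤ ‖v‖`.
  have hpt : ∀ z ∈ Icc 0 L, ‖m z‖ ^ 2 ≤ (1 + ‖v‖) * ‖n z‖ ^ 2 + 2 * K ^ 2 * ‖v‖ := by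
    intro z hz
    have h1 : ‖m z‖ ^ 2 ≤ (‖n z‖ + K * ‖v‖) ^ 2 := by gcongr; exact hmn z hz
    have h2 : 0 ≤ ‖v‖ * (‖n z‖ - K) ^ 2 := by positivity
    have h3 : 0 ≤ K ^ 2 * (‖v‖ * (1 - ‖v‖)) :=
      mul_nonneg (sq_nonneg K) (mul_nonneg (norm_nonneg v) (sub_nonneg.2 hv))
    linarith
  have hLI : L ∈ Icc 0 L := ⟨hL.le, le_rfl⟩
  have hni := intervalIntegrable_norm_sq hn hLI
  calc energy L m ≤ ∫ z in (0 : ℝ)..L, ((1 + ‖v‖) * ‖n z‖ ^ 2 + 2 * K ^ 2 * ‖v‖) :=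
        intervalIntegral.integral_mono_on hL.le (intervalIntegrable_norm_sq hmc hLI)
          ((hni.const_mul _).add intervalIntegrable_const) hpt
    _ = energy L n + ‖v‖ * (energy L n + 2 * K ^ 2 * L) := by
        rw [intervalIntegral.integral_add (hni.const_mul _) intervalIntegrable_const,
          intervalIntegral.integral_const_mul, intervalIntegral.integral_const, smul_eq_mul, energy]
        ring

/-! ### Noise balls -/

theorem mem_noiseBall {γ L E : ℝ} {x y : ℂ} :
    y ∈ noiseBall γ L E x ↔ ∃ n ∈ controls L, IsOutput γ L x n y ∧ energy L n ≤ E := by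
  simp only [noiseBall, reachSet, mem_iUnion, mem_ofPred_eq]
  constructor
  · rintro ⟨ε, hε, n, hn, ho, rfl⟩
    exact ⟨n, hn, ho, hε⟩
  · rintro ⟨n, hn, ho, hε⟩
    exact ⟨_, hε, n, hn, ho, rfl⟩

theorem noiseBall_mono {γ L E E' : ℝ} {x : ℂ} (h : E ≤ E') :
    noiseBall γ L E x ⊆ noiseBall γ L E' x := fun y hy => by
  obtain ⟨n, hn, ho, hE⟩ := mem_noiseBall.1 hy
  exact mem_noiseBall.2 ⟨n, hn, ho, hE.trans h⟩

/-- Without noise, the signal rotates with constant angular speed `γ ‖x‖ ^ 2`. -/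
theorem noiseBall_nonempty {γ L E : ℝ} {x : ℂ} (hE : 0 ≤ E) : (noiseBall γ L E x).Nonempty := by
  refine ⟨_, mem_noiseBall.2 ⟨fun _ => 0, continuousOn_const,
    ⟨fun z => x * Complex.exp (((γ * ‖x‖ ^ 2 * z : ℝ) : ℂ) * Complex.I), ⟨by simp, ?_⟩, rfl⟩,
    by simpa [energy] using hE⟩⟩
  intro z _
  have h1 : HasDerivAt (fun z : ℝ => ((γ * ‖x‖ ^ 2 * z : ℝ) : ℂ))
      ((γ * ‖x‖ ^ 2 * 1 : ℝ) : ℂ) z :=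
    ((hasDerivAt_id z).const_mul (γ * ‖x‖ ^ 2)).ofReal_comp
  have h2 := ((h1.mul_const Complex.I).cexp.const_mul x).hasDerivWithinAt (s := Icc 0 L)
  refine h2.congr_deriv ?_
  rw [norm_mul, Complex.norm_exp_ofReal_mul_I, mul_one]
  push_cast
  ring

theorem isBounded_noiseBall {γ L E : ℝ} {x : ℂ} (hL : 0 < L) :
    Bornology.IsBounded (noiseBall γ L E x) := by
  refine isBounded_iff_forall_norm_le.2 ⟨√(Real.exp L * (‖x‖ ^ 2 + E)), fun y hy => ?_⟩
  obtain ⟨n, hn, ⟨q, hq, rfl⟩, hE⟩ := mem_noiseBall.1 hy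
  exact Real.le_sqrt_of_sq_le ((hq.norm_sq_le hL hn ⟨hL.le, le_rfl⟩).trans (by gcongr))

/-- A larger noise ball contains a uniform thickening of a smaller one. -/
theorem exists_ball_subset_noiseBall {γ L E E' : ℝ} {x : ℂ} (hL : 0 < L) (hE : 0 < E)
    (hEE' : E < E') :
    ∃ δ > 0, ∀ y ∈ noiseBall γ L E x, Metric.ball y δ ⊆ noiseBall γ L E' x := by
  set R : ℝ := √(Real.exp L * (‖x‖ ^ 2 + E)) with hR
  set C : ℝ := E + 2 * (1 / L + |γ| * (3 * (R + 1) ^ 2)) ^ 2 * L with hC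
  have hC0 : 0 < C := by positivity
  refine ⟨min 1 ((E' - E) / C), lt_min one_pos (div_pos (sub_pos.2 hEE') hC0), ?_⟩
  intro y hy w hw
  obtain ⟨n, hn, ⟨q, hq, rfl⟩, hnE⟩ := mem_noiseBall.1 hy
  rw [mem_ball_iff_norm, lt_min_iff] at hw
  have hqR : ∀ z ∈ Icc 0 L, ‖q z‖ ≤ R := fun z hz =>
    Real.le_sqrt_of_sq_le ((hq.norm_sq_le hL hn hz).trans (by gcongr))
  obtain ⟨m, hm, ho, hmE⟩ := hq.exists_isOutput_add hL hn hqR hw.1.le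
  rw [add_sub_cancel] at ho
  refine mem_noiseBall.2 ⟨m, hm, ho, hmE.trans ?_⟩
  calc energy L n + ‖w - q L‖ * (energy L n + 2 * (1 / L + |γ| * (3 * (R + 1) ^ 2)) ^ 2 * L)
      ≤ E + ‖w - q L‖ * C := by rw [hC]; gcongr
    _ ≤ E' := by linarith [(lt_div_iff₀ hC0).1 hw.2]

end PerSample

theorem mainTheorem9 (γ L : ℝ) (hL : 0 < L) (x : ℂ) (E E' : ℝ) (hE : 0 < E) (hEE' : E < E') :
    PerSample.noiseBall γ L E x ⊂ PerSample.noiseBall γ L E' x ∧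
      ∀ y ∈ frontier (PerSample.noiseBall γ L E x),
        ∃ U : Set ℂ, IsOpen U ∧ y ∈ U ∧ U ⊆ PerSample.noiseBall γ L E' x := by
  obtain ⟨δ, hδ, hball⟩ := PerSample.exists_ball_subset_noiseBall (γ := γ) (x := x) hL hE hEE'
  refine ⟨(PerSample.noiseBall_mono hEE'.le).ssubset_of_ne fun heq => ?_, fun y hy => ?_⟩
  · rw [← heq] at hball
    -- Under equality, the ball is open and contains every point of its closure.
    have hopen : IsOpen (PerSample.noiseBall γ L E x) :=
      Metric.isOpen_iff.2 fun y hy => ⟨δ, hδ, hball y hy⟩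
    have hclosed : IsClosed (PerSample.noiseBall γ L E x) :=
      isClosed_of_closure_subset fun y hy => by
        obtain ⟨w, hw, hyw⟩ := Metric.mem_closure_iff.1 hy δ hδ
        exact hball w hw (Metric.mem_ball.2 hyw)
    have huniv := IsClopen.eq_univ ⟨hclosed, hopen⟩ (PerSample.noiseBall_nonempty hE.le)
    have hbdd := PerSample.isBounded_noiseBall (γ := γ) (E := E) (x := x) hL
    rw [huniv] at hbdd
    exact NormedSpace.unbounded_univ ℝ ℂ hbdd
  · obtain ⟨w, hw, hyw⟩ := Metric.mem_closure_iff.1 (frontier_subset_closure hy) δ hδ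
    exact ⟨Metric.ball w δ, Metric.isOpen_ball, Metric.mem_ball.2 hyw, hball w hw⟩
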